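/- Let $A$ be a finite totally ordered alphabet. A column on $A$ is identified with a subset of $A$. Column insertion of a letter $x$ into a column $\gamma$ gives the column $x\cdot\gamma$ equal to $\gamma\cup\{x\}$ if every element of $\gamma$ is $<x$, and to $(\gamma\setminus\{y\})\cup\{x\}$ otherwise, where $y$ is the smallest element of $\gamma$ with $y\ge x$. This extends to a left action of the free monoid $A^*$ on the set of columns; the stylic monoid $\mathrm{Styl}(A)$ is the monoid of endofunctions of the set of columns obtained in this way, and $\mu:A^*\to\mathrm{Styl}(A)$ is the canonical surjective homomorphism. A tableau on $A$ is a semistandard Young tableau with entries in $A$ (rows weakly increasing from left to right, columns strictly increasing from bottom to top). An $N$-tableau is a tableau whose rows are strictly increasing and in which each row is contained, as a set, in the row below. The $N$-insertion of a letter $x$ into an $N$-tableau replaces the first (bottom) row $B$, viewed as a subset of $A$, by $B\cup\{x\}$, and, if $B$ has elements $>x$, inserts the smallest of them in the same way into the tableau formed by the remaining rows (inserting $x$ into the empty tableau gives the one-box tableau $x$). For $w\in A^*$, $N(w)$ is obtained by $N$-inserting the letters of $w$ from left to right, starting with the empty tableau. **Theorem.** For each $w\in A^*$, $N(w)$ is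 an $N$-tableau which depends only on $\mu(w)$, and the induced mapping $\mu(w)\mapsto N(w)$ is a bijection from $\mathrm{Styl}(A)$ onto the set of $N$-tableaux on $A$. -/

import Mathlib

namespace Stylic

variable {A : Type*} [LinearOrder A]

/-- Column insertion of the letter `x` into the column `γ`, a column being viewed as the set of
its letters: if some element of `γ` is `≥ x`, the smallest such element is replaced by `x`;
otherwise `x` is added to `γ`. -/
def columnInsert (x : A) (γ : Finset A) : Finset A :=
  if h : {y ∈ γ | x ≤ y}.Nonempty then insert x (γ.erase ({y ∈ γ | x ≤ y}.min' h))
  else insert x γ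

variable (A) in
/-- The left action of the free monoid on columns, as a monoid homomorphism into the monoid of
endofunctions (under composition) of the set of columns: a letter acts by column insertion. -/
def columnAction : FreeMonoid A →* Function.End (Finset A) :=
  FreeMonoid.lift (fun x => (columnInsert x : Function.End (Finset A)))

variable (A) in
/-- The stylic monoid: the monoid of all endofunctions of the set of columns that are obtained
from the action of words. -/
abbrev Styl : Type _ := MonoidHom.mrange (columnAction A)

variable (A) in
/-- The canonical surjective homomorphism from the free monoid to the stylic monoid. -/
def toStyl : FreeMonoid A →* Styl A := (columnAction A).mrangeRestrict

/-- `S` may be placed as a row immediately above the row `R` in a tableau: it is not longer, and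
entries strictly increase from bottom to top in each column. -/
def Above (R S : List A) : Prop :=
  ∃ h : S.length ≤ R.length, ∀ (i : ℕ) (hi : i < S.length), R[i]'(hi.trans_le h) < S[i]

/-- A (semistandard) tableau on `A`, given by the list of its rows from bottom to top: the rows
are nonempty and weakly increasing, and the columns form a Young diagram and are strictly
increasing from bottom to top. -/
structure IsTableau (T : List (List A)) : Prop where
  row_ne_nil : ∀ R ∈ T, R ≠ []
  row_le : ∀ R ∈ T, R.Pairwise (· ≤ ·)
  col_lt : T.IsChain Above

/-- An N-tableau: a tableau whose rows are strictly increasing, and in which each row is contained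
(as a set) in the row below. -/
structure IsNTableau (T : List (List A)) : Prop extends IsTableau T where
  row_lt : ∀ R ∈ T, R.Pairwise (· < ·)
  row_subset : T.IsChain (fun R S => S ⊆ R)

variable (A) in
/-- The set of N-tableaux on `A`. -/
abbrev NTableau : Type _ := {T : List (List A) // IsNTableau T}

/-- N-insertion of a letter into the tableau with the given rows (from bottom to top): `x` is added
to the first row, viewed as a set, and if that row has elements `> x` then a copy of the smallest
of them is inserted in the same way into the tableau formed by the remaining rows. -/
def nInsert : List (List A) → A → List (List A)
  | [], x => [[x]]
  | R :: T, x =>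
    (insert x R.toFinset).sort (· ≤ ·) ::
      if h : {y ∈ R.toFinset | x < y}.Nonempty then
        nInsert T ({y ∈ R.toFinset | x < y}.min' h)
      else T

/-- The rows of `N(w)`: the letters of `w`, from left to right, are N-inserted successively,
starting with the empty tableau. -/
def nRows (w : FreeMonoid A) : List (List A) :=
  w.toList.foldl nInsert []

end Stylic

namespace Stylic

variable {A : Type*} [LinearOrder A]

/-! The invariant linking both sides is d(s, x), the greatest length of a strictly decreasing
subsequence of `w` with letters in (s, x]. By `hasChain_nInsert`, the chains of `N(w)`, read upwards
through the rows, have exactly the lengths of these subsequences.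

The action has the same data: by `le_countLE_columnAction_iff`, the number of letters ≤ x in w·γ is
the maximum over s ≤ x of d(s, x) plus the number of letters of γ that are ≤ s. For γ = {y ≤ s} the
maximum is attained at s itself, so the action gives back d (`hasChain_nRows_iff`). Hence `N(v) =
N(w)` exactly when `v` and `w` act alike, once an N-tableau is known to be determined by its chains
(`IsNTableau.ext_hasChain`). Surjectivity: reading the rows of an N-tableau from top to bottom gives
a word that inserts to it. -/

/-! ### Chains in nested rows -/

/-- There are letters `s < r₁ < ⋯ < rₙ ≤ x` with `rᵢ` in the `i`-th row of `T`. -/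
def HasChain : List (List A) → WithBot A → A → ℕ → Prop
  | _, _, _, 0 => True
  | [], _, _, _ + 1 => False
  | R :: T, s, x, n + 1 => ∃ r ∈ R, s < r ∧ r ≤ x ∧ HasChain T r x n

@[simp] lemma hasChain_zero (T : List (List A)) (s : WithBot A) (x : A) : HasChain T s x 0 := by
  cases T <;> simp [HasChain]

@[simp] lemma hasChain_nil_iff (s : WithBot A) (x : A) (n : ℕ) :
    HasChain [] s x n ↔ n = 0 := by
  cases n <;> simp [HasChain]

lemma hasChain_cons_succ (R : List A) (T : List (List A)) (s : WithBot A) (x : A) (n : ℕ) :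
    HasChain (R :: T) s x (n + 1) ↔ ∃ r ∈ R, s < r ∧ r ≤ x ∧ HasChain T r x n := by
  simp [HasChain]

lemma HasChain.anti_left {T : List (List A)} {s t : WithBot A} {x : A} {n : ℕ}
    (h : HasChain T t x n) (hst : s ≤ t) : HasChain T s x n := by
  match T, n, h with
  | _, 0, _ => simp
  | [], n + 1, h => simp at h
  | R :: T, n + 1, h =>
    rw [hasChain_cons_succ] at h ⊢
    obtain ⟨r, hr, htr, hrx, h⟩ := h
    exact ⟨r, hr, hst.trans_lt htr, hrx, h⟩

lemma HasChain.of_le {T : List (List A)} {s : WithBot A} {x : A} {m n : ℕ}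
    (h : HasChain T s x n) (hmn : m ≤ n) : HasChain T s x m := by
  induction T generalizing s m n with
  | nil => simp_all
  | cons R T ih =>
    match m, n, h, hmn with
    | 0, _, _, _ => simp
    | m + 1, n + 1, h, hmn =>
      rw [hasChain_cons_succ] at h ⊢
      obtain ⟨r, hr, hsr, hrx, h⟩ := h
      exact ⟨r, hr, hsr, hrx, ih h (by omega)⟩

lemma HasChain.lt_or_eq_zero {T : List (List A)} {s : WithBot A} {x : A} {n : ℕ}
    (h : HasChain T s x n) : s < x ∨ n = 0 := by
  match T, n, h with
  | _, 0, _ => simp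
  | [], n + 1, h => simp at h
  | R :: T, n + 1, h =>
    rw [hasChain_cons_succ] at h
    obtain ⟨r, hr, hsr, hrx, h⟩ := h
    exact Or.inl (hsr.trans_le (by exact_mod_cast hrx))

/-- The rows decrease, as sets, from bottom to top. -/
abbrev Nested (T : List (List A)) : Prop := T.IsChain (fun R S => S ⊆ R)

lemma HasChain.cons {R : List A} {T : List (List A)} (hT : Nested (R :: T)) {s : WithBot A}
    {x : A} {n : ℕ} (h : HasChain T s x n) : HasChain (R :: T) s x n := by
  induction T generalizing R s n with
  | nil => simp_all
  | cons S T ih =>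
    match n, h with
    | 0, _ => simp
    | n + 1, h =>
      rw [hasChain_cons_succ] at h ⊢
      obtain ⟨r, hr, hsr, hrx, h⟩ := h
      rw [Nested, List.isChain_cons_cons] at hT
      exact ⟨r, hT.1 hr, hsr, hrx, ih hT.2 h⟩

/-- This is the recursion for decreasing subsequences when a last letter `a` is appended: either `a`
is unused, or it is the smallest term and the others lie above it. -/
lemma hasChain_nInsert {T : List (List A)} (hT : Nested T) (a : A) (s : WithBot A) (x : A)
    (n : ℕ) :
    HasChain (nInsert T a) s x n ↔
      HasChain T s x n ∨ (s < a ∧ a ≤ x ∧ ∃ m, n = m + 1 ∧ HasChain T a x m) := by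
  induction T generalizing a s n with
  | nil =>
    cases n with
    | zero => simp
    | succ n =>
      rw [nInsert, hasChain_cons_succ]
      aesop
  | cons R T ih =>
    cases n with
    | zero => simp
    | succ n =>
      rw [nInsert, hasChain_cons_succ, hasChain_cons_succ]
      simp only [Finset.mem_sort, Finset.mem_insert, List.mem_toFinset]
      split_ifs with hb
      · set b := Finset.min' _ hb
        obtain ⟨hbR, hab⟩ : b ∈ R ∧ a < b := by
          simpa only [Finset.mem_filter, List.mem_toFinset] using Finset.min'_mem _ hb
        have hmin : ∀ r ∈ R, a < r → b ≤ r := fun r hr har =>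
          Finset.min'_le _ _ (by simp [hr, har])
        simp only [ih hT.tail]
        constructor
        · rintro ⟨r, hr, hsr, hrx, h⟩
          rcases hr with rfl | hr
          · refine Or.inr ⟨hsr, hrx, n, rfl, ?_⟩
            rcases h with h | ⟨hrb, hbx, m, rfl, h⟩
            · exact h.cons hT
            · exact (hasChain_cons_succ ..).2 ⟨b, hbR, hrb, hbx, h⟩
          · rcases h with h | ⟨hrb, hbx, m, rfl, h⟩
            · exact Or.inl ⟨r, hr, hsr, hrx, h⟩
            -- The chain passes through an old letter `r` and then the bumped `b`. Minimality of `b`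
            -- forces `r ≤ a`, so `a` can replace `r`, and `b` is then taken from `R` itself.
            · have hra : r ≤ a := by
                by_contra! har
                exact absurd (WithBot.coe_lt_coe.1 hrb) (hmin r hr har).not_gt
              refine Or.inr ⟨hsr.trans_le (by exact_mod_cast hra), hab.le.trans hbx, m + 1, rfl, ?_⟩
              exact (hasChain_cons_succ ..).2 ⟨b, hbR, by exact_mod_cast hab, hbx, h⟩
        · rintro (⟨r, hr, hsr, hrx, h⟩ | ⟨hsa, hax, m, hm, h⟩)
          · exact ⟨r, Or.inr hr, hsr, hrx, Or.inl h⟩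
          · obtain rfl : n = m := by omega
            refine ⟨a, Or.inl rfl, hsa, hax, ?_⟩
            cases n with
            | zero => simp
            | succ n =>
              rw [hasChain_cons_succ] at h
              obtain ⟨r, hr, har, hrx, h⟩ := h
              have hbr := hmin r hr (WithBot.coe_lt_coe.1 har)
              exact Or.inr ⟨by exact_mod_cast hab, hbr.trans hrx, n, rfl,
                h.anti_left (by exact_mod_cast hbr)⟩
      · have hmax : ∀ r ∈ R, ¬ a < r := fun r hr har => hb ⟨r, by simp [hr, har]⟩
        constructor
        · rintro ⟨r, rfl | hr, hsr, hrx, h⟩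
          · exact Or.inr ⟨hsr, hrx, n, rfl, h.cons hT⟩
          · exact Or.inl ⟨r, hr, hsr, hrx, h⟩
        · rintro (⟨r, hr, hsr, hrx, h⟩ | ⟨hsa, hax, m, hm, h⟩)
          · exact ⟨r, Or.inr hr, hsr, hrx, h⟩
          · obtain rfl : n = m := by omega
            refine ⟨a, Or.inl rfl, hsa, hax, ?_⟩
            cases n with
            | zero => simp
            | succ n =>
              rw [hasChain_cons_succ] at h
              obtain ⟨r, hr, har, -⟩ := h
              exact absurd (WithBot.coe_lt_coe.1 har) (hmax r hr)

/-! ### N-tableaux and their stability under N-insertion -/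

lemma above_cons_cons {r s : A} {R S : List A} (hrs : r < s) (h : Above R S) :
    Above (r :: R) (s :: S) := by
  obtain ⟨hlen, h⟩ := h
  refine ⟨by simpa using hlen, fun i hi => ?_⟩
  cases i with
  | zero => simpa using hrs
  | succ i => simpa using h i (by simpa using hi)

/-- If `S` misses the least letter of `R`, its i-th letter is at least the (i+1)-st of `R`. In the
induction, the head of `S` is the next witness. -/
lemma above_of_subset {R S : List A} (hR : R.Pairwise (· < ·)) (hS : S.Pairwise (· < ·))
    (hSR : S ⊆ R) (h : ∃ r ∈ R, ∀ s ∈ S, r < s) : Above R S := by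
  induction S generalizing R with
  | nil => exact ⟨by simp, fun i hi => by simp at hi⟩
  | cons s S ih =>
    cases R with
    | nil => simp at h
    | cons r R =>
      rw [List.pairwise_cons] at hR hS
      have hr : ∀ t ∈ s :: S, r < t := by
        obtain ⟨q, hq, h⟩ := h
        rcases List.mem_cons.1 hq with rfl | hq
        · exact h
        · exact fun t ht => (hR.1 q hq).trans (h t ht)
      have hsub : ∀ t ∈ s :: S, t ∈ R := fun t ht =>
        (List.mem_cons.1 (hSR ht)).resolve_left (hr t ht).ne'
      exact above_cons_cons (hr s (by simp)) (ih hR.2 hS.2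
        (fun t ht => hsub t (by simp [ht])) ⟨s, hsub s (by simp), hS.1⟩)

lemma Above.exists_lt {R S : List A} (h : Above R S) (hS : S.Pairwise (· < ·)) (hne : S ≠ []) :
    ∃ r ∈ R, ∀ s ∈ S, r < s := by
  obtain ⟨hlen, h⟩ := h
  cases S with
  | nil => exact absurd rfl hne
  | cons s S =>
    rw [List.pairwise_cons] at hS
    have h0 := h 0 (by simp)
    refine ⟨_, List.getElem_mem _, fun t ht => h0.trans_le ?_⟩
    rcases List.mem_cons.1 ht with rfl | ht
    · simp
    · simpa using (hS.1 t ht).le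

lemma isNTableau_nil : IsNTableau ([] : List (List A)) where
  row_ne_nil := by simp
  row_le := by simp
  col_lt := by simp
  row_lt := by simp
  row_subset := by simp

lemma isNTableau_cons {R : List A} {T : List (List A)} :
    IsNTableau (R :: T) ↔ R ≠ [] ∧ R.Pairwise (· < ·) ∧ IsNTableau T ∧
      ∀ S ∈ T.head?, S ⊆ R ∧ ∃ r ∈ R, ∀ s ∈ S, r < s := by
  constructor
  · intro h
    have hc := List.isChain_cons.1 h.col_lt
    have hs := List.isChain_cons.1 h.row_subset
    refine ⟨h.row_ne_nil R (by simp), h.row_lt R (by simp),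
      { row_ne_nil := fun S hS => h.row_ne_nil S (by simp [hS])
        row_le := fun S hS => h.row_le S (by simp [hS])
        col_lt := hc.2
        row_lt := fun S hS => h.row_lt S (by simp [hS])
        row_subset := hs.2 }, fun S hS => ⟨hs.1 S hS, ?_⟩⟩
    have hST : S ∈ R :: T := List.mem_cons_of_mem _ (List.mem_of_mem_head? hS)
    exact (hc.1 S hS).exists_lt (h.row_lt S hST) (h.row_ne_nil S hST)
  · rintro ⟨hne, hlt, hT, h⟩
    exact
      { row_ne_nil := List.forall_mem_cons.2 ⟨hne, hT.row_ne_nil⟩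
        row_le := List.forall_mem_cons.2 ⟨hlt.imp le_of_lt, hT.row_le⟩
        col_lt := List.isChain_cons.2 ⟨fun S hS => above_of_subset hlt
          (hT.row_lt S (List.mem_of_mem_head? hS)) (h S hS).1 (h S hS).2, hT.col_lt⟩
        row_lt := List.forall_mem_cons.2 ⟨hlt, hT.row_lt⟩
        row_subset := List.isChain_cons.2 ⟨fun S hS => (h S hS).1, hT.row_subset⟩ }

lemma IsNTableau.nested {T : List (List A)} (h : IsNTableau T) : Nested T := h.row_subset

lemma mem_of_mem_head?_nInsert {T : List (List A)} {b : A} {S : List A}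
    (hS : S ∈ (nInsert T b).head?) {s : A} (hs : s ∈ S) : s = b ∨ ∃ Q ∈ T.head?, s ∈ Q := by
  cases T with
  | nil =>
    simp only [nInsert, List.head?_cons, Option.mem_def, Option.some.injEq] at hS
    subst hS
    simpa using hs
  | cons R T =>
    simp only [nInsert, List.head?_cons, Option.mem_def, Option.some.injEq] at hS
    subst hS
    simpa using hs

lemma IsNTableau.nInsert {T : List (List A)} (hT : IsNTableau T) (a : A) :
    IsNTableau (nInsert T a) := by
  induction T generalizing a with
  | nil => simp [Stylic.nInsert, isNTableau_cons, isNTableau_nil]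
  | cons R T ih =>
    obtain ⟨hne, hlt, hT, h⟩ := isNTableau_cons.1 hT
    rw [Stylic.nInsert, isNTableau_cons]
    have hmem : ∀ r, r ∈ (insert a R.toFinset).sort (· ≤ ·) ↔ r = a ∨ r ∈ R := by simp
    refine ⟨List.ne_nil_of_mem ((hmem a).2 (Or.inl rfl)), ?_, ?_, ?_⟩
    · exact Finset.sortedLT_sort _ |>.pairwise
    · split_ifs
      exacts [ih hT _, hT]
    · intro S hS
      simp only [List.subset_def, hmem]
      split_ifs at hS with hb
      · set b := Finset.min' _ hb
        obtain ⟨hbR, hab⟩ : b ∈ R ∧ a < b := by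
          simpa only [Finset.mem_filter, List.mem_toFinset] using Finset.min'_mem _ hb
        have hmin : ∀ r ∈ R, a < r → b ≤ r := fun r hr har =>
          Finset.min'_le _ _ (by simp [hr, har])
        refine ⟨fun {s} hs => Or.inr ?_, ?_⟩
        · rcases mem_of_mem_head?_nInsert hS hs with rfl | ⟨Q, hQ, hsQ⟩
          exacts [hbR, (h Q hQ).1 hsQ]
        · by_cases hQ : ∃ Q ∈ T.head?, True
          · obtain ⟨Q, hQ, -⟩ := hQ
            obtain ⟨r, hr, hrQ⟩ := (h Q hQ).2
            have key : ∀ q, q < b → (∀ s ∈ Q, q < s) → ∀ s ∈ S, q < s := by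
              intro q hqb hq s hs
              rcases mem_of_mem_head?_nInsert hS hs with rfl | ⟨Q', hQ', hsQ⟩
              · exact hqb
              · obtain rfl := Option.mem_unique hQ hQ'
                exact hq s hsQ
            rcases lt_or_ge r b with hrb | hbr
            -- The letter below the whole second row is the old `r` if it is below the bumped `b`,
            -- and otherwise the inserted `a`.
            · exact ⟨r, Or.inr hr, key r hrb hrQ⟩
            · exact ⟨a, Or.inl rfl, key a hab fun s hs => (hab.trans_le hbr).trans (hrQ s hs)⟩
          · refine ⟨a, Or.inl rfl, fun s hs => ?_⟩
            rcases mem_of_mem_head?_nInsert hS hs with rfl | ⟨Q', hQ', -⟩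
            · exact hab
            · exact absurd ⟨Q', hQ', trivial⟩ hQ
      · obtain ⟨hs, r, hr, hrS⟩ := h S hS
        exact ⟨fun {s} hs' => Or.inr (hs hs'), r, Or.inr hr, hrS⟩

lemma IsNTableau.foldl {T : List (List A)} (hT : IsNTableau T) (l : List A) :
    IsNTableau (l.foldl Stylic.nInsert T) := by
  induction l generalizing T with
  | nil => exact hT
  | cons a l ih => exact ih (hT.nInsert a)

lemma isNTableau_nRows (w : FreeMonoid A) : IsNTableau (nRows w) :=
  isNTableau_nil.foldl _

/-! ### Reconstruction of an N-tableau from its chains, and surjectivity -/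

/-- A decreasing subsequence uses at most one letter of the increasing word `R`, as its last and
smallest term. -/
lemma hasChain_foldl_of_sorted {T : List (List A)} (hT : IsNTableau T) {R : List A}
    (hR : R.Pairwise (· < ·)) (s : WithBot A) (x : A) (n : ℕ) :
    HasChain (R.foldl nInsert T) s x n ↔ HasChain T s x n ∨
      ∃ r ∈ R, s < r ∧ r ≤ x ∧ ∃ m, n = m + 1 ∧ HasChain T r x m := by
  induction R using List.reverseRecOn generalizing s n with
  | nil => simp
  | append_singleton R a ih =>
    rw [List.pairwise_append] at hR
    have hlt : ∀ r ∈ R, r < a := fun r hr => hR.2.2 r hr a (by simp)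
    rw [List.foldl_append, List.foldl_cons, List.foldl_nil,
      hasChain_nInsert (hT.foldl R).nested, ih hR.1]
    have ha : ∀ m, HasChain (R.foldl nInsert T) a x m ↔ HasChain T a x m := by
      intro m
      rw [ih hR.1, or_iff_left]
      rintro ⟨r, hr, har, -⟩
      exact lt_asymm (hlt r hr) (WithBot.coe_lt_coe.1 har)
    simp only [ha, List.mem_append, List.mem_singleton, or_and_right, exists_or, or_assoc,
      exists_eq_left]

lemma exists_pred [Fintype A] (a : A) : ∃ p : WithBot A, ∀ r : A, p < r ↔ a ≤ r := by
  -- The predecessor of `a`, equal to `⊥` when `a` is the least letter.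
  refine ⟨({y | y < a} : Finset A).max, fun r => ?_⟩
  rw [Finset.max_eq_sup_withBot, Finset.sup_lt_iff (WithBot.bot_lt_coe r)]
  constructor
  · intro h
    by_contra! hr
    exact lt_irrefl _ (WithBot.coe_lt_coe.1 (h r (by simpa using hr)))
  · intro h y hy
    exact WithBot.coe_lt_coe.2 ((by simpa using hy : y < a).trans_le h)

lemma mem_iff_hasChain {R : List A} {T : List (List A)} (a : A) {p : WithBot A}
    (hp : ∀ r : A, p < r ↔ a ≤ r) : a ∈ R ↔ HasChain (R :: T) p a 1 := by
  rw [hasChain_cons_succ]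
  constructor
  · exact fun ha => ⟨a, ha, (hp a).2 le_rfl, le_rfl, by simp⟩
  · rintro ⟨r, hr, hpr, hra, -⟩
    rwa [← le_antisymm hra ((hp r).1 hpr)]

/-- The tail chain must be nonempty: this is what gives `a ≤ x`. -/
lemma hasChain_tail_iff {R : List A} {T : List (List A)} {a : A} (ha : a ∈ R) {p : WithBot A}
    (hp : ∀ r : A, p < r ↔ a ≤ r) (x : A) (n : ℕ) :
    HasChain T a x (n + 1) ↔ HasChain (R :: T) p x (n + 2) := by
  rw [hasChain_cons_succ (n := n + 1)]
  constructor
  · intro h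
    refine ⟨a, ha, (hp a).2 le_rfl, ?_, h⟩
    exact (WithBot.coe_lt_coe.1 (h.lt_or_eq_zero.resolve_right (by simp))).le
  · rintro ⟨r, hr, hpr, hra, h⟩
    exact h.anti_left (WithBot.coe_le_coe.2 ((hp r).1 hpr))

/-- A chain in the upper rows of an N-tableau may be started at a letter of the bottom row. -/
lemma IsNTableau.exists_mem_hasChain_iff {R : List A} (hR : R ≠ []) (s : WithBot A) :
    ∃ a ∈ R, ∀ T : List (List A), IsNTableau (R :: T) → ∀ x n,
      HasChain T s x n ↔ HasChain T a x n := by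
  obtain ⟨a, haR, ha⟩ : ∃ a ∈ R, ∀ S ⊆ R, (∃ r ∈ R, ∀ t ∈ S, r < t) →
      ∀ t ∈ S, s < (t : WithBot A) ↔ a < t := by
    by_cases hne : ({r ∈ R.toFinset | (r : WithBot A) ≤ s} : Finset A).Nonempty
    · obtain ⟨a, ha, hmax⟩ := Finset.exists_max_image _ id hne
      simp only [Finset.mem_filter, List.mem_toFinset, id] at ha hmax
      refine ⟨a, ha.1, fun S hS _ t ht => ⟨fun h => ?_, fun h => ?_⟩⟩
      · exact WithBot.coe_lt_coe.1 (ha.2.trans_lt h)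
      · by_contra! hts
        exact (hmax t ⟨hS ht, hts⟩).not_gt h
    · have hall : ∀ r ∈ R, s < (r : WithBot A) := fun r hr => by
        by_contra! h
        exact hne ⟨r, by simp [hr, h]⟩
      obtain ⟨a, ha, hmin⟩ := Finset.exists_min_image R.toFinset id (by simpa using hR)
      simp only [List.mem_toFinset, id] at ha hmin
      -- Here `s` is below all of `R`; the least letter of `R` serves because it lies below the
      -- whole next row.
      refine ⟨a, ha, fun S hS ⟨r, hr, h⟩ t ht => ⟨fun _ => ?_, fun _ => hall t (hS ht)⟩⟩
      exact (hmin r hr).trans_lt (h t ht)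
  refine ⟨a, haR, fun T hT x n => ?_⟩
  cases T with
  | nil => simp
  | cons S T =>
    cases n with
    | zero => simp
    | succ n =>
      have h := (isNTableau_cons.1 hT).2.2.2 S (by simp)
      simp only [hasChain_cons_succ, WithBot.coe_lt_coe]
      refine exists_congr fun t => and_congr_right fun ht => ?_
      rw [ha S h.1 h.2 t ht]

lemma IsNTableau.ext_hasChain [Fintype A] {T U : List (List A)} (hT : IsNTableau T) (hU : IsNTableau U)
    (h : ∀ s x n, HasChain T s x n ↔ HasChain U s x n) : T = U := by
  have key : ∀ (R : List A) (V : List (List A)), IsNTableau (R :: V) →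
      ∃ x, HasChain (R :: V) ⊥ x 1 := by
    intro R V hV
    obtain ⟨r, hr⟩ := List.exists_mem_of_ne_nil _ (isNTableau_cons.1 hV).1
    exact ⟨r, (hasChain_cons_succ ..).2 ⟨r, hr, WithBot.bot_lt_coe r, le_rfl, by simp⟩⟩
  induction T generalizing U with
  | nil =>
    cases U with
    | nil => rfl
    | cons S U =>
      obtain ⟨x, hx⟩ := key S U hU
      simpa using (h _ _ _).2 hx
  | cons R T ih =>
    cases U with
    | nil =>
      obtain ⟨x, hx⟩ := key R T hT
      simpa using (h _ _ _).1 hx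
    | cons S U =>
      obtain ⟨hR, hRlt, hT', -⟩ := isNTableau_cons.1 hT
      obtain ⟨-, hSlt, hU', -⟩ := isNTableau_cons.1 hU
      obtain rfl : R = S := by
        refine hRlt.sortedLT.eq_of_mem_iff hSlt.sortedLT fun a => ?_
        obtain ⟨p, hp⟩ := exists_pred a
        rw [mem_iff_hasChain (T := T) a hp, mem_iff_hasChain (T := U) a hp, h]
      congr 1
      refine ih hT' hU' fun s x n => ?_
      cases n with
      | zero => simp
      | succ n =>
        obtain ⟨a, ha, hs⟩ := IsNTableau.exists_mem_hasChain_iff hR s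
        obtain ⟨p, hp⟩ := exists_pred a
        rw [hs T hT, hs U hU, hasChain_tail_iff ha hp, hasChain_tail_iff ha hp, h]

lemma IsNTableau.exists_nRows_eq [Fintype A] {T : List (List A)} (hT : IsNTableau T) :
    ∃ w : FreeMonoid A, nRows w = T := by
  induction T with
  | nil => exact ⟨1, rfl⟩
  | cons R T ih =>
    obtain ⟨-, hR, hT', -⟩ := isNTableau_cons.1 hT
    obtain ⟨w, hw⟩ := ih hT'
    refine ⟨w * FreeMonoid.ofList R, (isNTableau_nRows _).ext_hasChain hT fun s x n => ?_⟩
    have : nRows (w * FreeMonoid.ofList R) = R.foldl Stylic.nInsert T := by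
      rw [← hw, nRows, nRows, FreeMonoid.toList_mul, List.foldl_append, FreeMonoid.toList_ofList]
    rw [this, hasChain_foldl_of_sorted hT' hR]
    cases n with
    | zero => simp
    | succ n =>
      -- By nesting, chains of `T` are already chains of `R :: T`.
      rw [or_iff_right_of_imp, hasChain_cons_succ]
      · simp
      · intro h
        simpa [hasChain_cons_succ] using h.cons hT.nested

/-! ### The column action through counting functions -/

/-- The number of letters of the column `γ` that are at most `s`. -/
def countLE (γ : Finset A) (s : WithBot A) : ℕ :=
  ({y ∈ γ | (y : WithBot A) ≤ s} : Finset A).card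

lemma countLE_mono (γ : Finset A) {s t : WithBot A} (h : s ≤ t) : countLE γ s ≤ countLE γ t :=
  Finset.card_le_card fun y hy => by
    simp only [Finset.mem_filter] at hy ⊢
    exact ⟨hy.1, hy.2.trans h⟩

lemma countLE_bot (γ : Finset A) : countLE γ ⊥ = 0 := by simp [countLE]

lemma mem_iff_countLE {γ : Finset A} {a : A} {p : WithBot A} (hp : ∀ r : A, p < r ↔ a ≤ r) :
    a ∈ γ ↔ countLE γ p < countLE γ a := by
  have hp' : ∀ r : A, (r : WithBot A) ≤ p ↔ r < a := fun r => by
    rw [← not_lt, hp, not_le]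
  simp only [countLE, hp', WithBot.coe_le_coe]
  constructor
  · intro ha
    refine Finset.card_lt_card ⟨fun y hy => ?_, fun h => ?_⟩
    · simp only [Finset.mem_filter] at hy ⊢
      exact ⟨hy.1, hy.2.le⟩
    · simpa using @h a (by simp [ha])
  · intro h
    by_contra ha
    refine h.ne (congrArg Finset.card (Finset.filter_congr fun y hy => ?_))
    exact ⟨le_of_lt, fun hya => lt_of_le_of_ne hya (by rintro rfl; exact ha hy)⟩

lemma ext_countLE [Fintype A] {γ δ : Finset A} (h : ∀ a : A, countLE γ a = countLE δ a) : γ = δ := by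
  have h' : ∀ s, countLE γ s = countLE δ s := fun s => by
    induction s with
    | bot => simp [countLE_bot]
    | coe a => exact h a
  ext a
  obtain ⟨p, hp⟩ := exists_pred a
  rw [mem_iff_countLE hp, mem_iff_countLE hp, h', h']

lemma countLE_insert {γ : Finset A} {a : A} (ha : a ∉ γ) (s : WithBot A) :
    countLE (insert a γ) s = countLE γ s + if (a : WithBot A) ≤ s then 1 else 0 := by
  rw [countLE, Finset.filter_insert]
  split_ifs with h
  · rw [Finset.card_insert_of_notMem (by simp [ha]), countLE]
  · rw [countLE, add_zero]

/-- Insertion adds one to the count exactly from `a` up to the replaced letter. There the old count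
equals its value at the predecessor `p` of `a`; beyond, it is already larger than that. -/
lemma countLE_columnInsert (γ : Finset A) {a : A} {p : WithBot A}
    (hp : ∀ r : A, p < r ↔ a ≤ r) (s : WithBot A) :
    countLE (columnInsert a γ) s =
      if (a : WithBot A) ≤ s then max (countLE γ s) (countLE γ p + 1) else countLE γ s := by
  have hp' : ∀ r : A, (r : WithBot A) ≤ p ↔ r < a := fun r => by
    rw [← not_lt, hp, not_le]
  have hpa : p < a := (hp a).2 le_rfl
  have heq : ∀ (δ : Finset A), (∀ y ∈ δ, a ≤ y → ¬ (y : WithBot A) ≤ s) → (a : WithBot A) ≤ s →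
      countLE δ s = countLE δ p := by
    intro δ hδ has
    refine congrArg Finset.card (Finset.filter_congr fun y hy => ⟨fun h => ?_, fun h => ?_⟩)
    · rw [hp']
      by_contra! hay
      exact hδ y hy hay h
    · exact h.trans (hpa.le.trans has)
  rw [columnInsert]
  split_ifs with hb has has
  · set b := Finset.min' _ hb
    obtain ⟨hbR, hab⟩ : b ∈ γ ∧ a ≤ b := by
      simpa only [Finset.mem_filter] using Finset.min'_mem _ hb
    have hmin : ∀ r ∈ γ, a ≤ r → b ≤ r := fun r hr har =>
      Finset.min'_le _ _ (by simp [hr, har])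
    have ha : a ∉ γ.erase b := fun h => by
      rw [Finset.mem_erase] at h
      exact h.1 (le_antisymm hab (hmin a h.2 le_rfl))
    have hγ : ∀ t, countLE γ t = countLE (γ.erase b) t + if (b : WithBot A) ≤ t then 1 else 0 := by
      intro t
      conv_lhs => rw [← Finset.insert_erase hbR]
      exact countLE_insert (by simp) t
    rw [countLE_insert ha, hγ s, hγ p, if_pos has, if_neg (c := (b : WithBot A) ≤ p)]
    · split_ifs with hbs
      · have := countLE_mono (γ.erase b) (hpa.le.trans has)
        omega
      · have := heq (γ.erase b) (fun y hy hay hys => hbs ((WithBot.coe_le_coe.2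
          (hmin y (Finset.mem_of_mem_erase hy) hay)).trans hys)) has
        omega
    · rw [hp']
      exact hab.not_gt
  · set b := Finset.min' _ hb
    obtain ⟨hbR, hab⟩ : b ∈ γ ∧ a ≤ b := by
      simpa only [Finset.mem_filter] using Finset.min'_mem _ hb
    have hmin : ∀ r ∈ γ, a ≤ r → b ≤ r := fun r hr har =>
      Finset.min'_le _ _ (by simp [hr, har])
    have ha : a ∉ γ.erase b := fun h => by
      rw [Finset.mem_erase] at h
      exact h.1 (le_antisymm hab (hmin a h.2 le_rfl))
    have hbs : ¬ (b : WithBot A) ≤ s := fun h => has ((WithBot.coe_le_coe.2 hab).trans h)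
    conv_rhs => rw [← Finset.insert_erase hbR]
    rw [countLE_insert ha, countLE_insert (by simp), if_neg has, if_neg hbs]
  · have hmax : ∀ r ∈ γ, ¬ a ≤ r := fun r hr har => hb ⟨r, by simp [hr, har]⟩
    rw [countLE_insert fun h => hmax a h le_rfl, if_pos has,
      heq γ (fun y hy hay => absurd hay (hmax y hy)) has]
    omega
  · have hmax : ∀ r ∈ γ, ¬ a ≤ r := fun r hr har => hb ⟨r, by simp [hr, har]⟩
    rw [countLE_insert fun h => hmax a h le_rfl, if_neg has, add_zero]

lemma le_countLE_columnAction_iff [Fintype A] (l : List A) (γ : Finset A) (x : A) (n : ℕ) :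
    n ≤ countLE (columnAction A (FreeMonoid.ofList l) γ) x ↔
      ∃ s : WithBot A, s ≤ x ∧ ∃ k, HasChain (nRows (FreeMonoid.ofList l)) s x k ∧
        n ≤ k + countLE γ s := by
  induction l using List.reverseRecOn generalizing γ with
  | nil =>
    have h1 : columnAction A (FreeMonoid.ofList []) γ = γ := by
      rw [FreeMonoid.ofList_nil, map_one]; rfl
    have h2 : nRows (FreeMonoid.ofList ([] : List A)) = [] := rfl
    rw [h1, h2]
    simp only [hasChain_nil_iff, exists_eq_left, zero_add]
    exact ⟨fun h => ⟨x, le_rfl, h⟩, fun ⟨s, hs, h⟩ => h.trans (countLE_mono γ hs)⟩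
  | append_singleton l a ih =>
    have h1 : columnAction A (FreeMonoid.ofList (l ++ [a])) γ =
        columnAction A (FreeMonoid.ofList l) (columnInsert a γ) := by
      rw [FreeMonoid.ofList_append, map_mul]; rfl
    have h2 : nRows (FreeMonoid.ofList (l ++ [a])) = nInsert (nRows (FreeMonoid.ofList l)) a := by
      simp [nRows]
    rw [h1, h2, ih]
    simp only [hasChain_nInsert (isNTableau_nRows _).nested]
    obtain ⟨p, hp⟩ := exists_pred a
    have hpa : p < a := (hp a).2 le_rfl
    simp only [countLE_columnInsert γ hp]
    constructor
    · rintro ⟨s, hsx, k, hk, hn⟩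
      by_cases h : n ≤ k + countLE γ s
      · exact ⟨s, hsx, k, Or.inl hk, h⟩
      · split_ifs at hn with has
        -- The gain comes from the inserted `a`: lowering the bound to `p` moves it from the column
        -- to the front of the chain.
        · exact ⟨p, hpa.le.trans (has.trans hsx), k + 1, Or.inr ⟨hpa,
            WithBot.coe_le_coe.1 (has.trans hsx), k, rfl, hk.anti_left has⟩, by omega⟩
        · exact absurd hn h
    · rintro ⟨s, hsx, k, hk | ⟨hsa, hax, m, rfl, hk⟩, hn⟩
      · refine ⟨s, hsx, k, hk, hn.trans ?_⟩
        split_ifs <;> omega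
      · refine ⟨a, WithBot.coe_le_coe.2 hax, m, hk, ?_⟩
        have hsp : countLE γ s ≤ countLE γ p := by
          refine Finset.card_le_card fun y hy => ?_
          simp only [Finset.mem_filter] at hy ⊢
          refine ⟨hy.1, not_lt.1 fun h => ?_⟩
          exact ((WithBot.coe_le_coe.2 ((hp y).1 h)).trans hy.2).not_gt hsa
        rw [if_pos le_rfl]
        omega

/-- Raising the lower bound from `s` to `t` shortens chains by at most the number of letters
in between. -/
lemma HasChain.raise [Fintype A] {T : List (List A)} (hT : Nested T) {s t : WithBot A} {x : A} {k n : ℕ}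
    (h : HasChain T s x k)
    (hk : n + countLE Finset.univ t ≤ k + countLE Finset.univ s) (hst : s ≤ t) :
    HasChain T t x n := by
  induction T generalizing s k n with
  | nil =>
    have := countLE_mono (Finset.univ : Finset A) hst
    simp_all
    omega
  | cons R T ih =>
    cases k with
    | zero =>
      have := countLE_mono (Finset.univ : Finset A) hst
      obtain rfl : n = 0 := by omega
      simp
    | succ k =>
      obtain ⟨r, hr, hsr, hrx, h'⟩ := (hasChain_cons_succ ..).1 h
      have := countLE_mono (Finset.univ : Finset A) hst
      rcases lt_or_ge t (r : WithBot A) with htr | hrt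
      · exact ((hasChain_cons_succ ..).2 ⟨r, hr, htr, hrx, h'⟩ :
          HasChain (R :: T) t x (k + 1)).of_le (by omega)
      -- As `r` lies in (s, t], dropping it costs one letter of the chain, paid for by the letters
      -- between `s` and `r`.
      · refine (ih hT.tail h' ?_ hrt).cons hT
        have : countLE (Finset.univ : Finset A) s < countLE Finset.univ (r : WithBot A) := by
          refine Finset.card_lt_card ⟨fun y hy => ?_, fun h => ?_⟩
          · simp only [Finset.mem_filter] at hy ⊢
            exact ⟨hy.1, hy.2.trans hsr.le⟩
          · exact hsr.not_ge (by simpa using @h r (by simp))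
        omega

lemma hasChain_nRows_iff [Fintype A] (l : List A) {s : WithBot A} {x : A} (hsx : s ≤ x) (n : ℕ) :
    HasChain (nRows (FreeMonoid.ofList l)) s x n ↔
      n + countLE Finset.univ s ≤ countLE (columnAction A (FreeMonoid.ofList l)
        ({y | (y : WithBot A) ≤ s} : Finset A)) x := by
  have hc : ∀ t, countLE ({y | (y : WithBot A) ≤ s} : Finset A) t =
      countLE Finset.univ (min s t) := fun t => by
    simp only [countLE, Finset.filter_filter, le_min_iff]
  simp only [le_countLE_columnAction_iff, hc]
  constructor
  · exact fun h => ⟨s, hsx, n, h, by simp⟩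
  · rintro ⟨t, htx, k, hk, hn⟩
    rcases le_total s t with hst | hts
    · rw [min_eq_left hst] at hn
      exact (hk.anti_left hst).of_le (by omega)
    · rw [min_eq_right hts] at hn
      exact hk.raise (isNTableau_nRows _).nested hn hts

lemma nRows_eq_iff [Fintype A] (v w : FreeMonoid A) :
    nRows v = nRows w ↔ columnAction A v = columnAction A w := by
  obtain ⟨v, rfl⟩ := FreeMonoid.ofList.surjective v
  obtain ⟨w, rfl⟩ := FreeMonoid.ofList.surjective w
  constructor
  · intro h
    refine funext fun γ => ext_countLE fun a => ?_
    refine eq_of_forall_le_iff fun n => ?_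
    rw [le_countLE_columnAction_iff, le_countLE_columnAction_iff, h]
  · intro h
    refine (isNTableau_nRows _).ext_hasChain (isNTableau_nRows _) fun s x n => ?_
    rcases le_or_gt s (x : WithBot A) with hsx | hxs
    · rw [hasChain_nRows_iff _ hsx, hasChain_nRows_iff _ hsx, h]
    · have : ∀ T : List (List A), HasChain T s x n ↔ n = 0 := fun T =>
        ⟨fun h => h.lt_or_eq_zero.resolve_left hxs.not_gt, by rintro rfl; simp⟩
      rw [this, this]

end Stylic

theorem theorem6p1 {A : Type*} [LinearOrder A] [Finite A] :
    ∃ f : Stylic.Styl A → Stylic.NTableau A,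
      (∀ w : FreeMonoid A, (f (Stylic.toStyl A w) : List (List A)) = Stylic.nRows w) ∧
        Function.Bijective f := by
  have := Fintype.ofFinite A
  have hsurj : Function.Surjective (Stylic.toStyl A) :=
    (Stylic.columnAction A).mrangeRestrict_surjective
  have heq : ∀ v w, Stylic.nRows v = Stylic.nRows w ↔ Stylic.toStyl A v = Stylic.toStyl A w := by
    intro v w
    rw [Stylic.nRows_eq_iff, Subtype.ext_iff]
    rfl
  choose g hg using hsurj
  have hf : ∀ w, Stylic.nRows (g (Stylic.toStyl A w)) = Stylic.nRows w := fun w =>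
    (heq _ _).2 (hg _)
  refine ⟨fun m => ⟨Stylic.nRows (g m), Stylic.isNTableau_nRows _⟩, hf, fun m m' h => ?_,
    fun T => ?_⟩
  · rw [← hg m, ← hg m']
    exact (heq _ _).1 (congrArg Subtype.val h)
  · obtain ⟨w, hw⟩ := T.2.exists_nRows_eq
    exact ⟨Stylic.toStyl A w, Subtype.ext ((hf w).trans hw)⟩
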